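/- Consider the Novikov equation $u_t+u^2u_x+\partial_xP_1+P_2=0$ on $[0,\infty)\times\mathbb R$, where $P_1=p*(\tfrac32uu_x^2+u^3)$, $P_2=\tfrac12\,p*(u_x^3)$ and $p(x)=\tfrac12e^{-|x|}$. **Conservative solutions.** A conservative solution is a function $u(t,x)$, $t\ge 0$, such that (i) every $u(t,\cdot)$ is absolutely continuous and in $H^1(\mathbb R)\cap W^{1,4}(\mathbb R)$, and $t\mapsto u(t,\cdot)$ is Lipschitz in $L^4$; (ii) for all $\phi\in C^1_c([0,\infty)\times\mathbb R)$ $$\iint\Big\{-u_x(\phi_t+u^2\phi_x)+\big(-\tfrac32uu_x^2-u^3+P_1+\partial_xP_2\big)\phi\Big\}\,dx\,dt-\int u_x(0,x)\phi(0,x)\,dx=0;$$ (iii) there are Radon measures $\mu_t$, $t\ge0$, weakly continuous in $t$, whose absolutely continuous part has density $u_x^4(t,\cdot)$, with $$\int_0^\infty\Big\{\int(\phi_t+u^2\phi_x)\,d\mu_t+\int\big(4u^3u_x^3-4u_x^3(P_1+\partial_xP_2)\big)\phi\,dx\Big\}dt+\int u_x^4(0,x)\phi(0,x)\,dx=0$$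 for all such $\phi$ (the integrals being convergent). **Characteristic coordinates.** Such a solution is represented by functions $(x,u,\alpha,\xi)(t,Y)$ with $\xi>0$ if the graph of $u(t,\cdot)$ is $\{(x(t,Y),u(t,Y)):Y\in\mathbb R\}$ for all $t\ge0$, and $x_t=u^2$, $x_Y=\xi\cos^4\frac\alpha2$, $u_Y=\frac12\xi\sin\alpha\cos^2\frac\alpha2$ (that is, $\alpha=2\arctan u_x$ and $\xi=(1+u_x^2)^2/Y_x$), $$u_t=-\partial_xP_1-P_2,\qquad \alpha_t=-u\sin^2\tfrac\alpha2+2u^3\cos^2\tfrac\alpha2-2\cos^2\tfrac\alpha2\,(P_1+\partial_xP_2),\qquad \xi_t=\xi\big[2u^3+u-2(P_1+\partial_xP_2)\big]\sin\alpha ,$$ with the nonlocal terms written as integrals in $Y$, and at $t=0$: $Y=\int_0^{x(0,Y)}(1+u_{0,x}^2)^2\,dx$, $u(0,Y)=u_0(x(0,Y))$, $\alpha(0,Y)=2\arctan u_{0,x}(x(0,Y))$ for a.e. $Y$, $\xi(0,Y)=1$, where $u_0=u(0,\cdot)$. The solution has generic singularities for $t\in[0,T]$ if it has a $C^\infty$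 representation such that, for $t\in[0,T]$, $\alpha\equiv\pi \pmod{2\pi}$ and $\alpha_Y=0$ imply $\alpha_t\ne0$ and $\alpha_{YY}\ne0$. **Paths and their length.** A piecewise regular path (for $t\in[0,T]$) is a family $u^\theta$, $\theta\in[0,1]$, of conservative solutions with representations that, at each time $t\ge 0$, are continuous in $(Y,\theta)$ and $C^\infty$ in $(Y,\theta)$ for $\theta$ in the intervals $(\theta_{i-1},\theta_i)$ of a finite partition $0=\theta_0<\dots<\theta_N=1$, such that $u^\theta$ has generic singularities for $t\in[0,T]$ for every $\theta\in[0,1]\setminus\{\theta_1,\dots,\theta_N\}$. Its length at time $t$ is $$\|\gamma^t\|=\inf_\eta\int_0^1\!\int_{\mathbb R}\Big(|\partial_\theta x+x_Y\eta|\,\xi+|\partial_\theta u+u_Y\eta|\,\xi+\tfrac12|\partial_\theta\alpha+\alpha_Y\eta|\,\xi+|\partial_\theta\xi+\xi_Y\eta+\xi\eta_Y|\Big)e^{-|x(t,Y)|}\,dY\,d\theta ,$$ the infimum being over all relabellings $\eta=\eta^\theta(Y)$ that are $C^\infty$ in $(Y,\theta)$ except at finitely many $\theta$. **The geodesic distance.**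 Let $E_1,E_2,T>0$ and let $\Sigma$ be the set of $f\in H^1\cap W^{1,4}$ with $\int(f^2+f_x^2)\,dx\le E_1$ and $\int f_x^4\,dx\le E_2$. For conservative solutions $u,\tilde u$ that have generic singularities for $t\in[0,T]$ and initial data in $C_c^\infty\cap\Sigma$, and for $t\in[0,T]$, let $d(u,\tilde u)$ be the infimum of $\|\gamma^t\|$ over all piecewise regular paths with $u^0(t)=u(t)$, $u^1(t)=\tilde u(t)$ and initial data in $\Sigma$ for all $\theta$. For arbitrary conservative solutions $u,\tilde u$ let $d(u,\tilde u)=\lim_n d(u^n,\tilde u^n)$, where $u^n,\tilde u^n$ are solutions of the previous kind with $u^n(t)\to u(t)$ and $\tilde u^n(t)\to\tilde u(t)$ in $H^1\cap W^{1,4}$. (Should the limit depend on the sequences, the smallest possible limit is meant; if there are no such sequences, $d=+\infty$.) **Proposition 7.2 (Comparison with the $L^1$ metric).** For all $E_1,E_2>0$ there is a constant $C>0$, depending only on $E_1$ and $E_2$, such that for all $T>0$, all $t\in[0,T]$ and all conservative solutions $u,\tilde u$ (so that $u(t),\tilde u(t)\in H^1(\mathbb R)\cap W^{1,4}(\mathbb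 R)$), with $d$ the geodesic distance at time $t$, $$\|(u(t,\cdot)-\tilde u(t,\cdot))\,e^{-|x|}\|_{L^1(\mathbb R)}\le C\,d(u,\tilde u).$$ -/

import Mathlib

noncomputable section

open MeasureTheory Set Filter Topology
open scoped ENNReal ContDiff

namespace Novikov

/-! ### The function spaces -/

/-- `f` is an absolutely continuous function in `H¹(ℝ) ∩ W^{1,4}(ℝ)`. An absolutely continuous
function is differentiable almost everywhere and `deriv f` is its weak derivative. -/
structure MemH1W14 (f : ℝ → ℝ) : Prop where
  absCont : ∀ a b : ℝ, AbsolutelyContinuousOnInterval f a b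
  memLp_two : MemLp f 2 volume
  deriv_memLp_two : MemLp (deriv f) 2 volume
  memLp_four : MemLp f 4 volume
  deriv_memLp_four : MemLp (deriv f) 4 volume

/-- The distance of `f` and `g` in the norm of `H¹(ℝ) ∩ W^{1,4}(ℝ)`. -/
def sobolevDist (f g : ℝ → ℝ) : ℝ≥0∞ :=
  eLpNorm (fun x => f x - g x) 2 volume + eLpNorm (fun x => deriv f x - deriv g x) 2 volume +
    (eLpNorm (fun x => f x - g x) 4 volume + eLpNorm (fun x => deriv f x - deriv g x) 4 volume)

/-- The total energy `∫ (f² + f_x²) dx`. -/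
def energy (f : ℝ → ℝ) : ℝ := ∫ x, (f x ^ 2 + deriv f x ^ 2)

/-- The set of all `f ∈ H¹ ∩ W^{1,4}` with energy at most `E₁` and `‖f_x‖_{L⁴}⁴ ≤ E₂`. -/
def energySet (E₁ E₂ : ℝ) : Set (ℝ → ℝ) :=
  {f | MemH1W14 f ∧ energy f ≤ E₁ ∧ ∫ x, deriv f x ^ 4 ≤ E₂}

/-! ### Conservative solutions of the Novikov equation

The equation is `u_t + u² u_x + ∂ₓP₁ + P₂ = 0` with `P₁ = p * (3/2 u u_x² + u³)`,
`P₂ = 1/2 p * u_x³`, `p(x) = 1/2 exp (-|x|)`. A function of time and space is written `u t x`;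
only times `t ≥ 0` are relevant. -/

/-- `P₁ = p * (3/2 f f_x² + f³)`. -/
def P₁ (f : ℝ → ℝ) (x : ℝ) : ℝ :=
  ∫ y, (1 / 2) * Real.exp (-|x - y|) * (3 / 2 * f y * deriv f y ^ 2 + f y ^ 3)

/-- `∂ₓP₂ = 1/2 p' * f_x³`, where `p'(z) = -1/2 sign(z) exp (-|z|)`. -/
def P₂x (f : ℝ → ℝ) (x : ℝ) : ℝ :=
  (1 / 4) * ((∫ y in Ioi x, Real.exp (-|x - y|) * deriv f y ^ 3) -
    ∫ y in Iic x, Real.exp (-|x - y|) * deriv f y ^ 3)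

/-- The transport derivative `φ_t + u² φ_x` of a test function `φ (t, x)`. -/
def transport (u : ℝ → ℝ → ℝ) (φ : ℝ × ℝ → ℝ) (t x : ℝ) : ℝ :=
  deriv (fun s => φ (s, x)) t + u t x ^ 2 * deriv (fun y => φ (t, y)) x

/-- The integrand of the weak form of the equation for `u_x`. -/
def weakIntegrand (u : ℝ → ℝ → ℝ) (φ : ℝ × ℝ → ℝ) (z : ℝ × ℝ) : ℝ :=
  -deriv (u z.1) z.2 * transport u φ z.1 z.2 +
    (-(3 / 2) * u z.1 z.2 * deriv (u z.1) z.2 ^ 2 - u z.1 z.2 ^ 3 + P₁ (u z.1) z.2 +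
      P₂x (u z.1) z.2) * φ z

/-- The source of the balance law for the measure with density `u_x⁴`. -/
def balanceSource (u : ℝ → ℝ → ℝ) (t x : ℝ) : ℝ :=
  4 * u t x ^ 3 * deriv (u t) x ^ 3 - 4 * deriv (u t) x ^ 3 * (P₁ (u t) x + P₂x (u t) x)

/-- `u` is a (global, energy) conservative solution of the Novikov equation, with initial datum
`u 0`. Test functions are the restrictions to `t ≥ 0` of functions in `C_c^1(ℝ²)`. -/
structure IsConservativeSolution (u : ℝ → ℝ → ℝ) : Prop where
  mem : ∀ t, 0 ≤ t → MemH1W14 (u t)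
  lipschitz : ∃ L : ℝ, ∀ s t, 0 ≤ s → 0 ≤ t →
    eLpNorm (fun x => u t x - u s x) 4 volume ≤ ENNReal.ofReal (L * |t - s|)
  weak : ∀ φ : ℝ × ℝ → ℝ, ContDiff ℝ 1 φ → HasCompactSupport φ →
    IntegrableOn (weakIntegrand u φ) (Ici 0 ×ˢ univ) ∧
      (∫ z in Ici (0 : ℝ) ×ˢ (univ : Set ℝ), weakIntegrand u φ z) -
        ∫ x, deriv (u 0) x * φ (0, x) = 0
  balance : ∃ μ : ℝ → Measure ℝ,
    (∀ t, 0 ≤ t → IsLocallyFiniteMeasure (μ t)) ∧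
    (∀ f : ℝ → ℝ, Continuous f → HasCompactSupport f →
      ContinuousOn (fun t => ∫ x, f x ∂(μ t)) (Ici 0)) ∧
    -- the absolutely continuous part of `μ t` has density `u_x⁴`
    (∀ t, 0 ≤ t → (μ t).rnDeriv volume =ᵐ[volume] fun x => ENNReal.ofReal (deriv (u t) x ^ 4)) ∧
    ∀ φ : ℝ × ℝ → ℝ, ContDiff ℝ 1 φ → HasCompactSupport φ →
      IntegrableOn (fun t => ∫ x, transport u φ t x ∂(μ t)) (Ici 0) ∧
      IntegrableOn (fun t => ∫ x, balanceSource u t x * φ (t, x)) (Ici 0) ∧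
      (∫ t in Ici (0 : ℝ),
          ((∫ x, transport u φ t x ∂(μ t)) + ∫ x, balanceSource u t x * φ (t, x))) +
        ∫ x, deriv (u 0) x ^ 4 * φ (0, x) = 0

/-! ### The semi-linear system in the characteristic coordinates `(t, Y)` -/

/-- `exp (-|∫_Z^Y ξ cos⁴(α/2)|)` -/
def kernel (α ξ : ℝ → ℝ) (Y Z : ℝ) : ℝ :=
  Real.exp (-|∫ s in Z..Y, ξ s * Real.cos (α s / 2) ^ 4|)

/-- The source `(3/2 u u_x² + u³) dx` of `P₁`, as a density in `Y`. -/
def source₁ (u α ξ : ℝ → ℝ) (Z : ℝ) : ℝ :=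
  (3 / 8 * u Z * Real.sin (α Z) ^ 2 + u Z ^ 3 * Real.cos (α Z / 2) ^ 4) * ξ Z

/-- Twice the source `u_x³ dx` of `P₂`, as a density in `Y`. -/
def source₂ (α ξ : ℝ → ℝ) (Z : ℝ) : ℝ := ξ Z * Real.sin (α Z) * Real.sin (α Z / 2) ^ 2

/-- `P₁` in the coordinate `Y`. -/
def lagP₁ (u α ξ : ℝ → ℝ) (Y : ℝ) : ℝ := (1 / 2) * ∫ Z, kernel α ξ Y Z * source₁ u α ξ Z

/-- `∂ₓP₁` in the coordinate `Y`. -/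
def lagP₁x (u α ξ : ℝ → ℝ) (Y : ℝ) : ℝ :=
  (1 / 2) * ((∫ Z in Ioi Y, kernel α ξ Y Z * source₁ u α ξ Z) -
    ∫ Z in Iic Y, kernel α ξ Y Z * source₁ u α ξ Z)

/-- `P₂` in the coordinate `Y`. -/
def lagP₂ (α ξ : ℝ → ℝ) (Y : ℝ) : ℝ := (1 / 8) * ∫ Z, kernel α ξ Y Z * source₂ α ξ Z

/-- `∂ₓP₂` in the coordinate `Y`. -/
def lagP₂x (α ξ : ℝ → ℝ) (Y : ℝ) : ℝ :=
  (1 / 8) * ((∫ Z in Ioi Y, kernel α ξ Y Z * source₂ α ξ Z) -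
    ∫ Z in Iic Y, kernel α ξ Y Z * source₂ α ξ Z)

/-- `(x, u, α, ξ)(t, Y)`, `t ≥ 0`, solves the semi-linear system with initial datum `u₀`. Here `Y`
is constant along the characteristics `x_t = u²`, `Y = ∫_0^x (1 + u_{0,x}²)² dx'` at time `0`,
`α = 2 arctan u_x` (an angle, so only relevant modulo `2π`) and `ξ = (1 + u_x²)² / Y_x`. -/
structure IsSemilinearSolution (x u α ξ : ℝ → ℝ → ℝ) (u₀ : ℝ → ℝ) : Prop where
  ξ_pos : ∀ t Y, 0 ≤ t → 0 < ξ t Y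
  x_t : ∀ t Y, 0 ≤ t → HasDerivWithinAt (fun s => x s Y) (u t Y ^ 2) (Ici 0) t
  u_t : ∀ t Y, 0 ≤ t → HasDerivWithinAt (fun s => u s Y)
    (-lagP₁x (u t) (α t) (ξ t) Y - lagP₂ (α t) (ξ t) Y) (Ici 0) t
  α_t : ∀ t Y, 0 ≤ t → HasDerivWithinAt (fun s => α s Y)
    (-u t Y * Real.sin (α t Y / 2) ^ 2 + 2 * u t Y ^ 3 * Real.cos (α t Y / 2) ^ 2 -
      2 * Real.cos (α t Y / 2) ^ 2 *
        (lagP₁ (u t) (α t) (ξ t) Y + lagP₂x (α t) (ξ t) Y)) (Ici 0) t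
  ξ_t : ∀ t Y, 0 ≤ t → HasDerivWithinAt (fun s => ξ s Y)
    (ξ t Y * (2 * u t Y ^ 3 + u t Y -
      2 * (lagP₁ (u t) (α t) (ξ t) Y + lagP₂x (α t) (ξ t) Y)) * Real.sin (α t Y)) (Ici 0) t
  /-- `ξ = (1 + u_x²)² / Y_x` -/
  x_Y : ∀ t Y, 0 ≤ t → HasDerivAt (x t) (ξ t Y * Real.cos (α t Y / 2) ^ 4) Y
  /-- `u_x = tan (α/2)`, multiplied by `x_Y` -/
  u_Y : ∀ t Y, 0 ≤ t →
    HasDerivAt (u t) (1 / 2 * ξ t Y * Real.sin (α t Y) * Real.cos (α t Y / 2) ^ 2) Y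
  x_init : ∀ Y, Y = ∫ z in (0 : ℝ)..x 0 Y, (1 + deriv u₀ z ^ 2) ^ 2
  u_init : ∀ Y, u 0 Y = u₀ (x 0 Y)
  /-- the derivative of `u₀` exists almost everywhere only -/
  α_init : ∀ᵐ Y, α 0 Y = 2 * Real.arctan (deriv u₀ (x 0 Y))
  ξ_init : ∀ Y, ξ 0 Y = 1

/-- At every time `t ≥ 0` the graph of `v t` is `{(x(t,Y), u(t,Y)) : Y ∈ ℝ}`. -/
def Represents (x u v : ℝ → ℝ → ℝ) : Prop :=
  ∀ t, 0 ≤ t → range (fun z => (z, v t z)) = range (fun Y => (x t Y, u t Y))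

/-- The solution `v` has generic singularities for `t ∈ [0, T]`. The singularities, `u_x = ±∞`,
are at `α ≡ π (mod 2π)`, that is at `cos (α/2) = 0`. -/
def HasGenericSingularities (T : ℝ) (v : ℝ → ℝ → ℝ) : Prop :=
  ∃ x u α ξ : ℝ → ℝ → ℝ,
    IsSemilinearSolution x u α ξ (v 0) ∧ Represents x u v ∧
    (ContDiffOn ℝ ∞ (fun p : ℝ × ℝ => x p.1 p.2) (Ici 0 ×ˢ univ) ∧
      ContDiffOn ℝ ∞ (fun p : ℝ × ℝ => u p.1 p.2) (Ici 0 ×ˢ univ) ∧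
      ContDiffOn ℝ ∞ (fun p : ℝ × ℝ => α p.1 p.2) (Ici 0 ×ˢ univ) ∧
      ContDiffOn ℝ ∞ (fun p : ℝ × ℝ => ξ p.1 p.2) (Ici 0 ×ˢ univ)) ∧
    ∀ t ∈ Icc 0 T, ∀ Y, Real.cos (α t Y / 2) = 0 → deriv (α t) Y = 0 →
      derivWithin (fun s => α s Y) (Ici 0) t ≠ 0 ∧ deriv (deriv (α t)) Y ≠ 0

/-! ### Piecewise regular paths and their length -/

/-- A path of solutions `θ ↦ v θ`, `θ ∈ [0, 1]`, that is piecewise regular for `t ∈ [0, T]`, with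
its representation `(x, u, α, ξ)(t, Y)` in characteristic coordinates (written `x θ t Y`).
Generic singularities for `t ∈ [0, T]` include generic singularities at `t = 0`. -/
structure RegularPath (T : ℝ) where
  (x u α ξ : ℝ → ℝ → ℝ → ℝ)
  /-- the solutions, written `v θ t x` -/
  v : ℝ → ℝ → ℝ → ℝ
  semilinear : ∀ θ ∈ Icc (0 : ℝ) 1, IsSemilinearSolution (x θ) (u θ) (α θ) (ξ θ) (v θ 0)
  represents : ∀ θ ∈ Icc (0 : ℝ) 1, Represents (x θ) (u θ) (v θ)
  conservative : ∀ θ ∈ Icc (0 : ℝ) 1, IsConservativeSolution (v θ)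
  continuousOn : ∀ t, 0 ≤ t →
    ContinuousOn (fun p : ℝ × ℝ => (x p.2 t p.1, u p.2 t p.1, α p.2 t p.1, ξ p.2 t p.1))
      (univ ×ˢ Icc 0 1)
  N : ℕ
  /-- the break points `0 = θ₀ < θ₁ < ⋯ < θ_N = 1` -/
  brk : ℕ → ℝ
  brk_zero : brk 0 = 0
  brk_last : brk N = 1
  brk_lt : ∀ i < N, brk i < brk (i + 1)
  smooth : ∀ t, 0 ≤ t → ∀ i < N,
    ContDiffOn ℝ ∞ (fun p : ℝ × ℝ => (x p.2 t p.1, u p.2 t p.1, α p.2 t p.1, ξ p.2 t p.1))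
      (univ ×ˢ Ioo (brk i) (brk (i + 1)))
  generic : ∀ θ ∈ Icc (0 : ℝ) 1, (∀ i ∈ Finset.Icc 1 N, θ ≠ brk i) →
    HasGenericSingularities T (v θ)

/-- A transportation plan: `η θ Y` is the infinitesimal relabelling `∂Y^ε/∂ε` at `ε = 0` of the
characteristics of the member `θ` of a path. It does not depend on time, since the label is
constant along characteristics, and it is smooth apart from finitely many values of `θ`. -/
def IsTransportPlan (η : ℝ → ℝ → ℝ) : Prop :=
  ∃ S : Finset ℝ, ContDiffOn ℝ ∞ (fun p : ℝ × ℝ => η p.2 p.1)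
    (univ ×ˢ (Ioo 0 1 \ (S : Set ℝ)))

namespace RegularPath

variable {T : ℝ} (γ : RegularPath T)

/-- Change in `x`: `J₁ = (X + x_Y η) ξ e^{-|x|}` with `X = ∂x/∂θ`. -/
def J₁ (η : ℝ → ℝ → ℝ) (t θ Y : ℝ) : ℝ :=
  (deriv (fun s => γ.x s t Y) θ + deriv (γ.x θ t) Y * η θ Y) * γ.ξ θ t Y *
    Real.exp (-|γ.x θ t Y|)

/-- Change in `u`: `J₂ = (U + u_Y η) ξ e^{-|x|}` with `U = ∂u/∂θ`. -/
def J₂ (η : ℝ → ℝ → ℝ) (t θ Y : ℝ) : ℝ :=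
  (deriv (fun s => γ.u s t Y) θ + deriv (γ.u θ t) Y * η θ Y) * γ.ξ θ t Y *
    Real.exp (-|γ.x θ t Y|)

/-- Change in `arctan u_x`: `J₃ = 1/2 (A + α_Y η) ξ e^{-|x|}` with `A = ∂α/∂θ`. -/
def J₃ (η : ℝ → ℝ → ℝ) (t θ Y : ℝ) : ℝ :=
  1 / 2 * (deriv (fun s => γ.α s t Y) θ + deriv (γ.α θ t) Y * η θ Y) * γ.ξ θ t Y *
    Real.exp (-|γ.x θ t Y|)

/-- Change in the measure `(1 + u_x²)² dx = ξ dY`: `J₄ = (ζ + ξ_Y η + ξ η_Y) e^{-|x|}` with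
`ζ = ∂ξ/∂θ`. -/
def J₄ (η : ℝ → ℝ → ℝ) (t θ Y : ℝ) : ℝ :=
  (deriv (fun s => γ.ξ s t Y) θ + deriv (γ.ξ θ t) Y * η θ Y + γ.ξ θ t Y * deriv (η θ) Y) *
    Real.exp (-|γ.x θ t Y|)

/-- The length of the path at time `t`, optimized over all transportation plans. -/
def length (t : ℝ) : ℝ≥0∞ :=
  ⨅ (η : ℝ → ℝ → ℝ) (_ : IsTransportPlan η),
    ∫⁻ θ in Icc (0 : ℝ) 1, ∫⁻ Y,
      ENNReal.ofReal (|γ.J₁ η t θ Y| + |γ.J₂ η t θ Y| + |γ.J₃ η t θ Y| + |γ.J₄ η t θ Y|)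

end RegularPath

/-! ### The geodesic distance -/

/-- `u` is a conservative solution with initial datum in `𝒟^∞ ∩ Σ`: the datum is in `C_c^∞`, it
obeys the bounds `E₁`, `E₂`, and the solution has generic singularities only for `t ∈ [0, T]`. -/
structure IsGenericSolution (E₁ E₂ T : ℝ) (u : ℝ → ℝ → ℝ) : Prop where
  conservative : IsConservativeSolution u
  smooth : ContDiff ℝ ∞ (u 0)
  compactSupport : HasCompactSupport (u 0)
  mem_energySet : u 0 ∈ energySet E₁ E₂
  generic : HasGenericSingularities T u

/-- The geodesic distance at time `t` of solutions with initial data in `𝒟^∞ ∩ Σ`: the infimum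
of the lengths at time `t` of all paths which are piecewise regular for `t ∈ [0, T]`, which
connect the two solutions at time `t`, and whose initial data obey the bounds `E₁`, `E₂`. -/
def genericDist (E₁ E₂ T t : ℝ) (u u' : ℝ → ℝ → ℝ) : ℝ≥0∞ :=
  ⨅ (γ : RegularPath T) (_ : γ.v 0 t = u t ∧ γ.v 1 t = u' t ∧
    ∀ θ ∈ Icc (0 : ℝ) 1, γ.v θ 0 ∈ energySet E₁ E₂), γ.length t

/-- `δ = lim d(uⁿ, u'ⁿ)` for some sequences of solutions with initial data in `𝒟^∞ ∩ Σ` that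
converge to `u` and `u'` in `H¹ ∩ W^{1,4}` at time `t`. -/
def IsDistLimit (E₁ E₂ T t : ℝ) (u u' : ℝ → ℝ → ℝ) (δ : ℝ≥0∞) : Prop :=
  ∃ a b : ℕ → ℝ → ℝ → ℝ,
    (∀ n, IsGenericSolution E₁ E₂ T (a n)) ∧ (∀ n, IsGenericSolution E₁ E₂ T (b n)) ∧
    Tendsto (fun n => sobolevDist (a n t) (u t)) atTop (𝓝 0) ∧
    Tendsto (fun n => sobolevDist (b n t) (u' t)) atTop (𝓝 0) ∧
    Tendsto (fun n => genericDist E₁ E₂ T t (a n) (b n)) atTop (𝓝 δ)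

/-- The geodesic distance `d(u, u')` at time `t ∈ [0, T]` of two conservative solutions: the limit
of the distances of approximating solutions. When the limit does not depend on the approximating
sequences, the set below has one element. In general the smallest limit is taken, so that
nothing about the limits is assumed. -/
def geodesicDist (E₁ E₂ T t : ℝ) (u u' : ℝ → ℝ → ℝ) : ℝ≥0∞ :=
  sInf {δ | IsDistLimit E₁ E₂ T t u u' δ}

end Novikov

end

/-!
The constant is `C = 1`. Fix a time `t` and a path `θ ↦ v θ`, and pair it with a test function
`ψ ∈ C_c^1` with `|ψ| ≤ exp (-|x|)`. In characteristic coordinates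
`∫ ψ(z) v θ t z dz = ∫ ψ(x) u x_Y dY`, and since `∂_θ (ψ(x) u x_Y) - ∂_Y (ψ(x) u x_θ)
= ψ(x) (u_θ x_Y - u_Y x_θ)`, the `θ`-derivative of the pairing is
`∫ ψ(x) (u_θ x_Y - u_Y x_θ) dY` (`hasDerivAt_integral_pullback`). For any relabelling `η`,
`u_θ x_Y - u_Y x_θ = (u_θ + u_Y η) x_Y - u_Y (x_θ + x_Y η)`, and `|x_Y|, |u_Y| ≤ ξ`, so this
derivative is at most `∫ (|J₁| + |J₂|) dY`. No division by `x_Y` occurs, so the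
singularities, where `x_Y = 0`, need no attention.

Integrating over `θ`, across the finitely many break points, and taking the supremum over `ψ`
(`lintegral_weighted_le_of_forall_test`) bounds the weighted `L¹` distance of the end points by the
length of the path. The `Y`-integrals are over one bounded interval for all `θ`, because
`x` is continuous in `θ`, and increasing and onto in `Y`
(`exists_forall_lt_of_monotone_surjective`).
For general solutions the bound passes to the limit, because the weighted `L¹` distance
is controlled by the `L²` distance, by Hölder's inequality.
-/

noncomputable section

open MeasureTheory Set Filter Topology
open scoped ENNReal ContDiff

namespace Novikov

/-! ### Differentiation of the pulled back area form -/

theorem hasDerivAt_integral_of_contDiffOn {f : ℝ × ℝ → ℝ} {a b : ℝ}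
    (hf : ContDiffOn ℝ 1 f (univ ×ˢ Ioo a b)) (c d : ℝ) {θ : ℝ} (hθ : θ ∈ Ioo a b) :
    HasDerivAt (fun s => ∫ Y in c..d, f (Y, s)) (∫ Y in c..d, fderiv ℝ f (Y, θ) (0, 1)) θ := by
  have hopen : IsOpen (univ ×ˢ Ioo a b : Set (ℝ × ℝ)) := isOpen_univ.prod isOpen_Ioo
  have hfc := hf.continuousOn
  have hf'c : ContinuousOn (fun p => fderiv ℝ f p (0, 1)) (univ ×ˢ Ioo a b) :=
    (hf.continuousOn_fderiv_of_isOpen hopen le_rfl).clm_apply continuousOn_const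
  obtain ⟨δ, hδ, hball⟩ : ∃ δ > 0, Icc (θ - δ) (θ + δ) ⊆ Ioo a b := by
    refine ⟨min (θ - a) (b - θ) / 2, by
      have := sub_pos.2 hθ.1; have := sub_pos.2 hθ.2; positivity, fun s hs => ?_⟩
    have h1 := min_le_left (θ - a) (b - θ)
    have h2 := min_le_right (θ - a) (b - θ)
    have h3 : 0 < min (θ - a) (b - θ) := lt_min (sub_pos.2 hθ.1) (sub_pos.2 hθ.2)
    constructor <;> linarith [hs.1, hs.2]
  have hslice : ∀ s ∈ Ioo a b, Continuous fun Y => f (Y, s) := fun s hs =>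
    hfc.comp_continuous (by fun_prop) fun Y => ⟨mem_univ _, hs⟩
  have hslice' : ∀ s ∈ Ioo a b, Continuous fun Y => fderiv ℝ f (Y, s) (0, 1) := fun s hs =>
    hf'c.comp_continuous (f := fun Y => (Y, s)) (by fun_prop) fun Y => ⟨mem_univ _, hs⟩
  obtain ⟨K, hK⟩ := (isCompact_uIcc (a := c) (b := d)).prod (isCompact_Icc (a := θ - δ) (b := θ + δ))
    |>.exists_bound_of_continuousOn (hf'c.mono (prod_mono (subset_univ _) hball))
  refine (intervalIntegral.hasDerivAt_integral_of_dominated_loc_of_deriv_le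
    (F := fun s Y => f (Y, s)) (F' := fun s Y => fderiv ℝ f (Y, s) (0, 1)) (bound := fun _ => K)
    (s := Icc (θ - δ) (θ + δ)) (Icc_mem_nhds (by linarith) (by linarith)) ?_
    ((hslice θ hθ).intervalIntegrable _ _) (hslice' θ hθ).aestronglyMeasurable ?_
    intervalIntegrable_const ?_).2
  · filter_upwards [isOpen_Ioo.mem_nhds hθ] with s hs
    exact (hslice s hs).aestronglyMeasurable
  · exact .of_forall fun Y hY s hs => hK (Y, s) ⟨uIoc_subset_uIcc hY, hs⟩
  · refine .of_forall fun Y _ s hs => ?_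
    have h1 : HasFDerivAt f (fderiv ℝ f (Y, s)) (Y, s) :=
      ((hf.differentiableOn one_ne_zero).differentiableAt
        (hopen.mem_nhds ⟨mem_univ _, hball hs⟩)).hasFDerivAt
    exact h1.comp_hasDerivAt s ((hasDerivAt_const s Y).prodMk (hasDerivAt_id s))

/-- The derivative in the parameter of `∫ ψ(x) u x_Y dY`. Moving the derivative of `ψ` to the total
`Y`-derivative of `ψ(x) u x_θ`, which integrates to zero, leaves the pullback of
`ψ(x) du ∧ dx`; the mixed second derivatives of `x` cancel. -/
theorem hasDerivAt_integral_pullback {x u : ℝ × ℝ → ℝ} {ψ : ℝ → ℝ} {a b M : ℝ}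
    (hψ : ContDiff ℝ 1 ψ) (hx : ContDiffOn ℝ 2 x (univ ×ˢ Ioo a b))
    (hu : ContDiffOn ℝ 1 u (univ ×ˢ Ioo a b)) {θ : ℝ} (hθ : θ ∈ Ioo a b)
    (hM : ψ (x (M, θ)) = 0) (hM' : ψ (x (-M, θ)) = 0) :
    HasDerivAt (fun s => ∫ Y in -M..M, ψ (x (Y, s)) * u (Y, s) * fderiv ℝ x (Y, s) (1, 0))
      (∫ Y in -M..M, ψ (x (Y, θ)) * (fderiv ℝ u (Y, θ) (0, 1) * fderiv ℝ x (Y, θ) (1, 0) -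
        fderiv ℝ u (Y, θ) (1, 0) * fderiv ℝ x (Y, θ) (0, 1))) θ := by
  have hopen : IsOpen (univ ×ˢ Ioo a b : Set (ℝ × ℝ)) := isOpen_univ.prod isOpen_Ioo
  have hDx : ContDiffOn ℝ 1 (fderiv ℝ x) (univ ×ˢ Ioo a b) :=
    hx.fderiv_of_isOpen hopen (by norm_num)
  have hC : ∀ w : ℝ × ℝ, ContDiffOn ℝ 1 (fun p => ψ (x p) * u p * fderiv ℝ x p w)
      (univ ×ˢ Ioo a b) := fun w =>
    ((hψ.comp_contDiffOn (hx.of_le (by norm_num))).mul hu).mul (hDx.clm_apply contDiffOn_const)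
  have hmem : ∀ Y, (Y, θ) ∈ (univ ×ˢ Ioo a b : Set (ℝ × ℝ)) := fun Y => ⟨mem_univ _, hθ⟩
  have hline : Continuous fun Y : ℝ => (Y, θ) := by fun_prop
  have hD : ∀ (w : ℝ × ℝ) (Y : ℝ), HasFDerivAt (fun p => ψ (x p) * u p * fderiv ℝ x p w)
      (fderiv ℝ (fun p => ψ (x p) * u p * fderiv ℝ x p w) (Y, θ)) (Y, θ) := fun w Y =>
    (((hC w).differentiableOn one_ne_zero).differentiableAt
      (hopen.mem_nhds (hmem Y))).hasFDerivAt
  have hDeq : ∀ (w z : ℝ × ℝ) (Y : ℝ),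
      fderiv ℝ (fun p => ψ (x p) * u p * fderiv ℝ x p w) (Y, θ) z =
        ψ (x (Y, θ)) * u (Y, θ) * fderiv ℝ (fderiv ℝ x) (Y, θ) z w +
        fderiv ℝ x (Y, θ) w * (ψ (x (Y, θ)) * fderiv ℝ u (Y, θ) z +
          u (Y, θ) * (deriv ψ (x (Y, θ)) * fderiv ℝ x (Y, θ) z)) := by
    intro w z Y
    have hn := hopen.mem_nhds (hmem Y)
    have h1 : HasFDerivAt x _ (Y, θ) :=
      ((hx.differentiableOn two_ne_zero).differentiableAt hn).hasFDerivAt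
    have h2 : HasFDerivAt u _ (Y, θ) :=
      ((hu.differentiableOn one_ne_zero).differentiableAt hn).hasFDerivAt
    have h3 : HasFDerivAt (fderiv ℝ x) _ (Y, θ) :=
      ((hDx.differentiableOn one_ne_zero).differentiableAt hn).hasFDerivAt
    have h4 := ((hψ.differentiable one_ne_zero (x (Y, θ))).hasDerivAt.comp_hasFDerivAt _ h1)
    have h5 := (h4.mul h2).mul (h3.clm_apply (hasFDerivAt_const w (Y, θ)))
    have h6 := congrArg (fun A : ℝ × ℝ →L[ℝ] ℝ => A z) ((hD w Y).unique h5)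
    simp only [_root_.add_apply, _root_.smul_apply, smul_eq_mul,
      ContinuousLinearMap.comp_apply, ContinuousLinearMap.flip_apply, Function.comp_apply,
      _root_.zero_apply, map_zero, zero_add] at h6
    rw [h6]
    simp
  have hint : ∀ w z : ℝ × ℝ, IntervalIntegrable
      (fun Y => fderiv ℝ (fun p => ψ (x p) * u p * fderiv ℝ x p w) (Y, θ) z) volume (-M) M :=
    fun w z => Continuous.intervalIntegrable
      ((((hC w).continuousOn_fderiv_of_isOpen hopen le_rfl).clm_apply
        continuousOn_const).comp_continuous hline hmem) _ _
  have hzero : ∫ Y in -M..M,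
      fderiv ℝ (fun p => ψ (x p) * u p * fderiv ℝ x p (0, 1)) (Y, θ) (1, 0) = 0 := by
    have hg : ∀ Y, HasDerivAt (fun Y => ψ (x (Y, θ)) * u (Y, θ) * fderiv ℝ x (Y, θ) (0, 1))
        (fderiv ℝ (fun p => ψ (x p) * u p * fderiv ℝ x p (0, 1)) (Y, θ) (1, 0)) Y := fun Y =>
      (hD (0, 1) Y).comp_hasDerivAt (f := fun Y => (Y, θ)) Y
        ((hasDerivAt_id Y).prodMk (hasDerivAt_const Y θ))
    rw [intervalIntegral.integral_eq_sub_of_hasDerivAt (fun Y _ => hg Y) (hint _ _), hM, hM']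
    simp
  have hmain : ∫ Y in -M..M, ψ (x (Y, θ)) * (fderiv ℝ u (Y, θ) (0, 1) * fderiv ℝ x (Y, θ) (1, 0) -
        fderiv ℝ u (Y, θ) (1, 0) * fderiv ℝ x (Y, θ) (0, 1)) =
      ∫ Y in -M..M, fderiv ℝ (fun p => ψ (x p) * u p * fderiv ℝ x p (1, 0)) (Y, θ) (0, 1) := by
    refine Eq.trans ?_ ((intervalIntegral.integral_sub (hint (1, 0) (0, 1))
      (hint (0, 1) (1, 0))).trans (by rw [hzero, sub_zero]))
    refine intervalIntegral.integral_congr fun Y _ => ?_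
    have hsymm := ((hx.contDiffAt (hopen.mem_nhds (hmem Y))).isSymmSndFDerivAt (by simp)).eq
      (0, 1) (1, 0)
    simp only [hDeq, hsymm]
    ring
  rw [hmain]
  exact hasDerivAt_integral_of_contDiffOn (hC (1, 0)) (-M) M hθ

/-! ### Auxiliary facts of real analysis -/

/-- Increasing surjections depending continuously on a parameter in a compact set leave `[-R, R]`
at a place `± M` that does not depend on the parameter. -/
theorem exists_forall_lt_of_monotone_surjective {x : ℝ → ℝ → ℝ} {K : Set ℝ} (hK : IsCompact K)
    (hc : ∀ Y, ContinuousOn (fun θ => x θ Y) K) (hmono : ∀ θ ∈ K, Monotone (x θ))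
    (hsurj : ∀ θ ∈ K, Function.Surjective (x θ)) (R : ℝ) :
    ∃ M, 0 ≤ M ∧ ∀ θ ∈ K, R < x θ M ∧ x θ (-M) < -R := by
  suffices h : ∃ M, 0 ≤ M ∧ ∀ θ ∈ K, θ ∈ K → R < x θ M ∧ x θ (-M) < -R by
    obtain ⟨M, h0, h⟩ := h
    exact ⟨M, h0, fun θ hθ => h θ hθ hθ⟩
  refine hK.induction_on (p := fun s => ∃ M, 0 ≤ M ∧ ∀ θ ∈ s, θ ∈ K → R < x θ M ∧ x θ (-M) < -R)
    ⟨0, le_rfl, by simp⟩ ?_ ?_ ?_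
  · rintro s t hst ⟨M, h0, h⟩
    exact ⟨M, h0, fun θ hθ => h θ (hst hθ)⟩
  · rintro s t ⟨M, h0, h⟩ ⟨M', h0', h'⟩
    refine ⟨max M M', le_max_of_le_left h0, ?_⟩
    rintro θ (hθ | hθ) hθK
    · exact ⟨(h θ hθ hθK).1.trans_le (hmono θ hθK (le_max_left _ _)),
        (hmono θ hθK (neg_le_neg (le_max_left _ _))).trans_lt (h θ hθ hθK).2⟩
    · exact ⟨(h' θ hθ hθK).1.trans_le (hmono θ hθK (le_max_right _ _)),
        (hmono θ hθK (neg_le_neg (le_max_right _ _))).trans_lt (h' θ hθ hθK).2⟩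
  · intro θ hθ
    obtain ⟨Y, hY⟩ := hsurj θ hθ (R + 1)
    obtain ⟨Z, hZ⟩ := hsurj θ hθ (-R - 1)
    have h1 : R < x θ (max (max Y (-Z)) 0) := by
      have := hmono θ hθ ((le_max_left Y (-Z)).trans (le_max_left _ 0))
      linarith
    have h2 : x θ (-max (max Y (-Z)) 0) < -R := by
      have := hmono θ hθ (neg_le.1 ((le_max_right Y (-Z)).trans (le_max_left _ 0)))
      linarith
    refine ⟨{s | R < x s (max (max Y (-Z)) 0) ∧ x s (-max (max Y (-Z)) 0) < -R}, ?_, _,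
      le_max_right _ _, fun s hs _ => hs⟩
    exact (((hc _) θ hθ).eventually (lt_mem_nhds h1)).and (((hc _) θ hθ).eventually (gt_mem_nhds h2))

/-- No measurability of the majorant `K` is needed, since `deriv F` is always measurable. -/
theorem enorm_sub_le_lintegral_of_hasDerivAt {F F' : ℝ → ℝ} {K : ℝ → ℝ≥0∞} {a b : ℝ} (hab : a ≤ b)
    (hF : ContinuousOn F (Icc a b)) (hF' : ∀ s ∈ Ioo a b, HasDerivAt F (F' s) s)
    (hK : ∀ s ∈ Ioo a b, ‖F' s‖ₑ ≤ K s) : ‖F b - F a‖ₑ ≤ ∫⁻ s in Ioc a b, K s := by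
  rcases eq_or_ne (∫⁻ s in Ioc a b, K s) ⊤ with h | h
  · simp [h]
  have hle : ∫⁻ s in Ioc a b, ‖deriv F s‖ₑ ≤ ∫⁻ s in Ioc a b, K s := by
    rw [← setLIntegral_congr (μ := volume) Ioo_ae_eq_Ioc,
      ← setLIntegral_congr (μ := volume) Ioo_ae_eq_Ioc]
    exact setLIntegral_mono' measurableSet_Ioo fun s hs => (hF' s hs).deriv ▸ hK s hs
  have hint : IntervalIntegrable (deriv F) volume a b := by
    rw [intervalIntegrable_iff_integrableOn_Ioc_of_le hab]
    exact ⟨(measurable_deriv F).aestronglyMeasurable, hle.trans_lt h.lt_top⟩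
  rw [← intervalIntegral.integral_eq_sub_of_hasDerivAt_of_le hab hF
    (fun s hs => (hF' s hs).differentiableAt.hasDerivAt) hint,
    intervalIntegral.integral_of_le hab]
  exact (enorm_integral_le_lintegral_enorm _).trans hle

/-- A weighted `L¹` norm is the supremum of the pairings with the `C_c^1` functions dominated by the
weight. A nearly optimal `ψ` is a smooth approximation of `χ w g / (|g| + ε)` with a cutoff
`χ`. -/
theorem lintegral_weighted_le_of_forall_test {g w : ℝ → ℝ} (hg : Continuous g) (hw : Continuous w)
    (hw0 : ∀ z, 0 < w z) (hwi : Integrable w) {K : ℝ≥0∞}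
    (hK : ∀ ψ : ℝ → ℝ, ContDiff ℝ 1 ψ → HasCompactSupport ψ → (∀ z, |ψ z| ≤ w z) →
      ‖∫ z, ψ z * g z‖ₑ ≤ K) :
    ∫⁻ z, ENNReal.ofReal (|g z| * w z) ≤ K := by
  have hcut : ∀ χ : ℝ → ℝ, Continuous χ → HasCompactSupport χ → (∀ z, 0 ≤ χ z) → (∀ z, χ z ≤ 1) →
      ENNReal.ofReal (∫ z, χ z * (|g z| * w z)) ≤ K := by
    intro χ hχ hχs hχ0 hχ1
    have key : ∀ ε > 0, ENNReal.ofReal (∫ z, χ z * (|g z| * w z)) ≤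
        K + ENNReal.ofReal (2 * ε * ∫ z, w z) := by
      intro ε hε
      have hpos : ∀ z, 0 < |g z| + ε := fun z => by positivity
      -- The approximation error `w ε / (|g| + ε)` is exactly what is left between
      -- `|χ w g / (|g| + ε)|` and `w`, so that `|ψ| ≤ w` holds without a loss.
      obtain ⟨ψ, hψ, hψd, hψs⟩ := Continuous.exists_contDiff_approx
        (f := fun z => χ z * (w z * g z / (|g z| + ε))) (ε := fun z => w z * ε / (|g z| + ε)) 1
        (hχ.mul ((hw.mul hg).div (by fun_prop) fun z => (hpos z).ne'))
        ((hw.mul continuous_const).div (by fun_prop) fun z => (hpos z).ne')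
        (fun z => div_pos (mul_pos (hw0 z) hε) (hpos z))
      have hψχ : Function.support ψ ⊆ Function.support χ :=
        hψs.trans (Function.support_mul_subset_left _ _)
      have hψc : HasCompactSupport ψ := hχs.mono hψχ
      have hψw : ∀ z, |ψ z| ≤ w z := by
        intro z
        have h1 := (hψd z).le
        rw [Real.dist_eq] at h1
        have h2 : |χ z * (w z * g z / (|g z| + ε))| ≤ w z * |g z| / (|g z| + ε) := by
          rw [abs_mul, abs_div, abs_mul, abs_of_pos (hw0 z), abs_of_pos (hpos z),
            abs_of_nonneg (hχ0 z)]
          exact mul_le_of_le_one_left (div_nonneg (mul_nonneg (hw0 z).le (abs_nonneg _))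
            (hpos z).le) (hχ1 z)
        have h3 : w z * |g z| / (|g z| + ε) + w z * ε / (|g z| + ε) = w z := by
          have := (hpos z).ne'
          field_simp
        have h4 := abs_sub_abs_le_abs_sub (ψ z) (χ z * (w z * g z / (|g z| + ε)))
        linarith
      have hpt : ∀ z, χ z * (|g z| * w z) ≤ ψ z * g z + 2 * ε * w z := by
        intro z
        have h1 := (hψd z).le
        rw [Real.dist_eq] at h1
        have h0 := (hpos z).ne'
        have hw' := hw0 z
        have h2 : |ψ z - χ z * (w z * g z / (|g z| + ε))| * |g z| ≤ w z * ε := by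
          calc _ ≤ w z * ε / (|g z| + ε) * |g z| := by gcongr
            _ = w z * ε * (|g z| / (|g z| + ε)) := by ring
            _ ≤ w z * ε * 1 := by
              gcongr
              exact (div_le_one (hpos z)).2 (by linarith)
            _ = w z * ε := mul_one _
        rw [← abs_mul] at h2
        have h3 := (abs_le.1 h2).1
        have h4 : χ z * (|g z| * w z) - χ z * (w z * g z / (|g z| + ε)) * g z ≤ ε * w z := by
          have : χ z * (|g z| * w z) - χ z * (w z * g z / (|g z| + ε)) * g z =
              χ z * (ε * w z * (|g z| / (|g z| + ε))) := by
            field_simp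
            rw [← sq_abs (g z)]
            ring
          rw [this]
          have h5 : |g z| / (|g z| + ε) ≤ 1 := (div_le_one (hpos z)).2 (by linarith)
          have h6 : 0 ≤ |g z| / (|g z| + ε) := by positivity
          calc _ ≤ 1 * (ε * w z * 1) := by gcongr; exact hχ1 z
            _ = ε * w z := by ring
        linarith
      have hi1 : Integrable fun z => ψ z * g z :=
        (hψ.continuous.mul hg).integrable_of_hasCompactSupport hψc.mul_right
      have hi2 : Integrable fun z => χ z * (|g z| * w z) :=
        (hχ.mul (hg.abs.mul hw)).integrable_of_hasCompactSupport hχs.mul_right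
      calc ENNReal.ofReal (∫ z, χ z * (|g z| * w z))
          ≤ ENNReal.ofReal (‖∫ z, ψ z * g z‖ + 2 * ε * ∫ z, w z) := by
            refine ENNReal.ofReal_le_ofReal ?_
            have := integral_mono hi2 (hi1.add (hwi.const_mul (2 * ε))) hpt
            simp only [Pi.add_apply] at this
            rw [integral_add hi1 (hwi.const_mul _), integral_const_mul] at this
            exact this.trans (by gcongr; exact le_abs_self _)
        _ ≤ ENNReal.ofReal ‖∫ z, ψ z * g z‖ + _ := ENNReal.ofReal_add_le
        _ ≤ K + ENNReal.ofReal (2 * ε * ∫ z, w z) := by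
          gcongr
          rw [ofReal_norm]
          exact hK ψ (by exact_mod_cast hψ) hψc hψw
    have hlim : Tendsto (fun ε : ℝ => K + ENNReal.ofReal (2 * ε * ∫ z, w z)) (𝓝[>] 0) (𝓝 K) := by
      have : Tendsto (fun ε : ℝ => K + ENNReal.ofReal (2 * ε * ∫ z, w z)) (𝓝 0)
          (𝓝 (K + ENNReal.ofReal (2 * 0 * ∫ z, w z))) :=
        tendsto_const_nhds.add ((ENNReal.continuous_ofReal.comp (by fun_prop)).tendsto 0)
      simpa using this.mono_left nhdsWithin_le_nhds
    exact ge_of_tendsto hlim (eventually_mem_nhdsWithin.mono key)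
  have hcover : ∀ n : ℕ, ∫⁻ z in Icc (-(n : ℝ)) n, ENNReal.ofReal (|g z| * w z) ≤ K := by
    intro n
    let χ : ℝ → ℝ := fun z => max 0 (min 1 (n + 1 - |z|))
    have hχ : Continuous χ := by fun_prop
    have hχs : HasCompactSupport χ :=
      HasCompactSupport.intro (isCompact_Icc (a := -((n : ℝ) + 1)) (b := n + 1)) fun z hz => by
        refine max_eq_left (min_le_of_right_le ?_)
        by_contra! h
        exact hz (abs_le.1 (by linarith))
    have hχ0 : ∀ z, 0 ≤ χ z := fun z => le_max_left _ _
    have hi : Integrable fun z => χ z * (|g z| * w z) :=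
      (hχ.mul (hg.abs.mul hw)).integrable_of_hasCompactSupport hχs.mul_right
    refine le_trans ?_ (hcut χ hχ hχs hχ0 fun z => max_le zero_le_one (min_le_left _ _))
    rw [ofReal_integral_eq_lintegral_ofReal hi (.of_forall fun z =>
      mul_nonneg (hχ0 z) (mul_nonneg (abs_nonneg _) (hw0 z).le))]
    refine (setLIntegral_mono' measurableSet_Icc fun z hz => ?_).trans
      (setLIntegral_le_lintegral (Icc (-(n : ℝ)) n) _)
    have : χ z = 1 := by
      have := abs_le.2 hz
      simp only [χ]
      rw [min_eq_left (by linarith), max_eq_right zero_le_one]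
    rw [this, one_mul]
  refine le_of_tendsto' ((aecover_Icc (μ := volume) (tendsto_neg_atTop_atBot.comp
    tendsto_natCast_atTop_atTop) tendsto_natCast_atTop_atTop).lintegral_tendsto_of_countably_generated
    (f := fun z => ENNReal.ofReal (|g z| * w z)) ?_) hcover
  exact (ENNReal.continuous_ofReal.comp (hg.abs.mul hw)).measurable.aemeasurable

theorem integrable_exp_neg_abs : Integrable fun z : ℝ => Real.exp (-|z|) := by
  rw [← integrableOn_univ, ← Iic_union_Ioi (a := (0 : ℝ))]
  exact ((integrableOn_exp_Iic 0).congr_fun (fun z hz => by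
      rw [abs_of_nonpos (mem_Iic.1 hz), neg_neg]) measurableSet_Iic).union
    ((integrableOn_exp_neg_Ioi 0).congr_fun (fun z hz => by
      rw [abs_of_pos (mem_Ioi.1 hz)]) measurableSet_Ioi)

/-! ### Solutions at a fixed time -/

theorem MemH1W14.continuous {f : ℝ → ℝ} (hf : MemH1W14 f) : Continuous f :=
  continuous_iff_continuousAt.2 fun z =>
    (hf.absCont (z - 1) (z + 1)).continuousOn.continuousAt <| by
      rw [uIcc_of_le (by linarith)]
      exact Icc_mem_nhds (by linarith) (by linarith)

theorem Represents.apply_eq {x u v : ℝ → ℝ → ℝ} (h : Represents x u v) {t : ℝ} (ht : 0 ≤ t)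
    (Y : ℝ) : v t (x t Y) = u t Y := by
  have hY : (x t Y, u t Y) ∈ range fun z => (z, v t z) := h t ht ▸ mem_range_self Y
  obtain ⟨z, hz⟩ := hY
  obtain ⟨rfl, h2⟩ := Prod.mk.inj hz
  exact h2

theorem Represents.surjective {x u v : ℝ → ℝ → ℝ} (h : Represents x u v) {t : ℝ} (ht : 0 ≤ t) :
    Function.Surjective (x t) := by
  intro z
  have hz : (z, v t z) ∈ range fun Y => (x t Y, u t Y) := h t ht ▸ mem_range_self z
  obtain ⟨Y, hY⟩ := hz
  exact ⟨Y, (Prod.mk.inj hY).1⟩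

theorem IsSemilinearSolution.monotone {x u α ξ : ℝ → ℝ → ℝ} {u₀ : ℝ → ℝ}
    (h : IsSemilinearSolution x u α ξ u₀) {t : ℝ} (ht : 0 ≤ t) : Monotone (x t) :=
  monotone_of_hasDerivAt_nonneg (fun Y => h.x_Y t Y ht) fun Y =>
    mul_nonneg (h.ξ_pos t Y ht).le (by positivity)

theorem abs_half_mul_sin_mul_cos_sq_le {ξ : ℝ} (hξ : 0 ≤ ξ) (a : ℝ) :
    |1 / 2 * ξ * Real.sin a * Real.cos (a / 2) ^ 2| ≤ ξ := by
  rw [abs_mul, abs_mul, abs_mul, abs_of_nonneg hξ, abs_of_pos one_half_pos,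
    abs_of_nonneg (sq_nonneg (Real.cos _))]
  have h1 := Real.abs_sin_le_one a
  have h2 := Real.cos_sq_le_one (a / 2)
  calc 1 / 2 * ξ * |Real.sin a| * Real.cos (a / 2) ^ 2 ≤ 1 / 2 * ξ * 1 * 1 := by gcongr
    _ ≤ ξ := by linarith

theorem mul_cos_pow_four_le {ξ : ℝ} (hξ : 0 ≤ ξ) (a : ℝ) :
    ξ * Real.cos (a / 2) ^ 4 ≤ ξ := by
  refine mul_le_of_le_one_right hξ ?_
  rw [show Real.cos (a / 2) ^ 4 = (Real.cos (a / 2) ^ 2) ^ 2 by ring]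
  exact pow_le_one₀ (sq_nonneg _) (Real.cos_sq_le_one _)

/-! ### Comparison with the length of a path -/

namespace RegularPath

variable {T : ℝ} (γ : RegularPath T)

theorem brk_mono {i j : ℕ} (hij : i ≤ j) (hj : j ≤ γ.N) : γ.brk i ≤ γ.brk j := by
  induction j, hij using Nat.le_induction with
  | base => exact le_rfl
  | succ k _ ih => exact (ih (by omega)).trans (γ.brk_lt k (by omega)).le

theorem brk_mem {i : ℕ} (hi : i ≤ γ.N) : γ.brk i ∈ Icc (0 : ℝ) 1 :=
  ⟨γ.brk_zero ▸ γ.brk_mono (Nat.zero_le i) hi, γ.brk_last ▸ γ.brk_mono hi le_rfl⟩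

/-- The pairing `∫ ψ(z) v θ t z dz` in characteristic coordinates, cut off at `|Y| ≤ M`; the factor
`ξ cos⁴(α/2)` is `x_Y`. -/
def testPairing (ψ : ℝ → ℝ) (M t θ : ℝ) : ℝ :=
  ∫ Y in -M..M, ψ (γ.x θ t Y) * γ.u θ t Y * (γ.ξ θ t Y * Real.cos (γ.α θ t Y / 2) ^ 4)

variable {γ} {ψ : ℝ → ℝ} {M t θ : ℝ}

theorem testPairing_eq_integral (hψ : Continuous ψ) (ht : 0 ≤ t) (hθ : θ ∈ Icc (0 : ℝ) 1)
    (hsupp : Function.support ψ ⊆ Ioc (γ.x θ t (-M)) (γ.x θ t M)) :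
    γ.testPairing ψ M t θ = ∫ z, ψ z * γ.v θ t z := by
  have hv : Continuous (γ.v θ t) := ((γ.conservative θ hθ).mem t ht).continuous
  have hslice : Continuous fun Y => (γ.x θ t Y, γ.u θ t Y, γ.α θ t Y, γ.ξ θ t Y) :=
    (γ.continuousOn t ht).comp_continuous (f := fun Y => (Y, θ)) (by fun_prop)
      fun Y => ⟨mem_univ _, hθ⟩
  have hα : Continuous (γ.α θ t) := hslice.snd.snd.fst
  have hξ : Continuous (γ.ξ θ t) := hslice.snd.snd.snd
  have hcv := intervalIntegral.integral_comp_mul_deriv (a := -M) (b := M)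
    (g := fun z => ψ z * γ.v θ t z) (fun Y _ => (γ.semilinear θ hθ).x_Y t Y ht)
    (by fun_prop) (hψ.mul hv)
  rw [intervalIntegral.integral_eq_integral_of_support_subset
    ((Function.support_mul_subset_left _ _).trans hsupp)] at hcv
  rw [← hcv]
  refine intervalIntegral.integral_congr fun Y _ => ?_
  simp only [Function.comp_apply, (γ.represents θ hθ).apply_eq ht]

theorem continuousOn_testPairing (hψ : Continuous ψ) (M : ℝ) (ht : 0 ≤ t) :
    ContinuousOn (γ.testPairing ψ M t) (Icc 0 1) := by
  -- The path is extended by constants to all `θ`, since continuity of parametric integrals is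
  -- available for globally continuous integrands.
  have hc : Continuous fun p : ℝ × ℝ => (γ.x (projIcc 0 1 zero_le_one p.1) t p.2,
      γ.u (projIcc 0 1 zero_le_one p.1) t p.2, γ.α (projIcc 0 1 zero_le_one p.1) t p.2,
      γ.ξ (projIcc 0 1 zero_le_one p.1) t p.2) :=
    (γ.continuousOn t ht).comp_continuous
      (f := fun p : ℝ × ℝ => (p.2, ((projIcc 0 1 zero_le_one p.1 : Icc (0 : ℝ) 1) : ℝ)))
      (continuous_snd.prodMk (continuous_subtype_val.comp (continuous_projIcc.comp continuous_fst)))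
      fun p => ⟨mem_univ _, Subtype.coe_prop _⟩
  have hcont : Continuous fun s : ℝ => γ.testPairing ψ M t (projIcc 0 1 zero_le_one s) := by
    refine intervalIntegral.continuous_parametric_intervalIntegral_of_continuous' ?_ _ _
    exact ((hψ.comp hc.fst).mul hc.snd.fst).mul (hc.snd.snd.snd.mul
      ((Real.continuous_cos.comp (hc.snd.snd.fst.div_const 2)).pow 4))
  exact hcont.continuousOn.congr fun s hs => by simp only [projIcc_of_mem zero_le_one hs]

/-- Away from the break points, the speed of the pairing is at most `∫ (|J₁| + |J₂|) dY`, whatever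
the relabelling `η` is. -/
theorem exists_hasDerivAt_testPairing (hψ : ContDiff ℝ 1 ψ)
    (hψw : ∀ z, |ψ z| ≤ Real.exp (-|z|)) (hM : 0 ≤ M) (ht : 0 ≤ t) {i : ℕ} (hi : i < γ.N)
    (hθ : θ ∈ Ioo (γ.brk i) (γ.brk (i + 1))) (hψM : ψ (γ.x θ t M) = 0)
    (hψM' : ψ (γ.x θ t (-M)) = 0) (η : ℝ → ℝ → ℝ) :
    ∃ D : ℝ, HasDerivAt (γ.testPairing ψ M t) D θ ∧
      ‖D‖ₑ ≤ ∫⁻ Y, ENNReal.ofReal (|γ.J₁ η t θ Y| + |γ.J₂ η t θ Y|) := by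
  have hopen : IsOpen (univ ×ˢ Ioo (γ.brk i) (γ.brk (i + 1)) : Set (ℝ × ℝ)) :=
    isOpen_univ.prod isOpen_Ioo
  have hsub : Ioo (γ.brk i) (γ.brk (i + 1)) ⊆ Icc 0 1 := fun s hs =>
    ⟨(γ.brk_mem hi.le).1.trans hs.1.le, hs.2.le.trans (γ.brk_mem hi).2⟩
  have hx := (γ.smooth t ht i hi).fst
  have hu := (γ.smooth t ht i hi).snd.fst
  simp only at hx hu
  have hDx : ∀ s ∈ Ioo (γ.brk i) (γ.brk (i + 1)), ∀ Y, HasFDerivAt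
      (fun p : ℝ × ℝ => γ.x p.2 t p.1) (fderiv ℝ (fun p : ℝ × ℝ => γ.x p.2 t p.1) (Y, s)) (Y, s) :=
    fun s hs Y => ((hx.differentiableOn (by simp)).differentiableAt
      (hopen.mem_nhds ⟨mem_univ _, hs⟩)).hasFDerivAt
  have hDu : ∀ s ∈ Ioo (γ.brk i) (γ.brk (i + 1)), ∀ Y, HasFDerivAt
      (fun p : ℝ × ℝ => γ.u p.2 t p.1) (fderiv ℝ (fun p : ℝ × ℝ => γ.u p.2 t p.1) (Y, s)) (Y, s) :=
    fun s hs Y => ((hu.differentiableOn (by simp)).differentiableAt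
      (hopen.mem_nhds ⟨mem_univ _, hs⟩)).hasFDerivAt
  have hxY : ∀ s ∈ Ioo (γ.brk i) (γ.brk (i + 1)), ∀ Y,
      fderiv ℝ (fun p : ℝ × ℝ => γ.x p.2 t p.1) (Y, s) (1, 0) =
        γ.ξ s t Y * Real.cos (γ.α s t Y / 2) ^ 4 := fun s hs Y =>
    ((hDx s hs Y).comp_hasDerivAt (f := fun Y => (Y, s)) Y ((hasDerivAt_id Y).prodMk
      (hasDerivAt_const Y s))).unique ((γ.semilinear s (hsub hs)).x_Y t Y ht)
  have huY : ∀ Y, fderiv ℝ (fun p : ℝ × ℝ => γ.u p.2 t p.1) (Y, θ) (1, 0) =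
        1 / 2 * γ.ξ θ t Y * Real.sin (γ.α θ t Y) * Real.cos (γ.α θ t Y / 2) ^ 2 := fun Y =>
    ((hDu θ hθ Y).comp_hasDerivAt (f := fun Y => (Y, θ)) Y ((hasDerivAt_id Y).prodMk
      (hasDerivAt_const Y θ))).unique ((γ.semilinear θ (hsub hθ)).u_Y t Y ht)
  have hxθ : ∀ Y, fderiv ℝ (fun p : ℝ × ℝ => γ.x p.2 t p.1) (Y, θ) (0, 1) =
      deriv (fun s => γ.x s t Y) θ := fun Y =>
    ((hDx θ hθ Y).comp_hasDerivAt (f := fun s => (Y, s)) θ ((hasDerivAt_const θ Y).prodMk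
      (hasDerivAt_id θ))).deriv.symm
  have huθ : ∀ Y, fderiv ℝ (fun p : ℝ × ℝ => γ.u p.2 t p.1) (Y, θ) (0, 1) =
      deriv (fun s => γ.u s t Y) θ := fun Y =>
    ((hDu θ hθ Y).comp_hasDerivAt (f := fun s => (Y, s)) θ ((hasDerivAt_const θ Y).prodMk
      (hasDerivAt_id θ))).deriv.symm
  have hderiv := hasDerivAt_integral_pullback hψ
    (hx.of_le (by norm_cast)) (hu.of_le (by norm_cast)) hθ hψM hψM'
  refine ⟨_, hderiv.congr_of_eventuallyEq ?_, ?_⟩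
  · filter_upwards [isOpen_Ioo.mem_nhds hθ] with s hs
    simp only [testPairing, hxY s hs]
  rw [intervalIntegral.integral_of_le (by linarith)]
  refine (enorm_integral_le_lintegral_enorm _).trans
    ((setLIntegral_le_lintegral _ _).trans (lintegral_mono fun Y => ?_))
  rw [← ofReal_norm]
  refine ENNReal.ofReal_le_ofReal ?_
  have hs := γ.semilinear θ (hsub hθ)
  have hξ := (hs.ξ_pos t Y ht).le
  rw [hxY θ hθ, huY, hxθ, huθ, J₁, J₂, (hs.x_Y t Y ht).deriv, (hs.u_Y t Y ht).deriv,
    Real.norm_eq_abs, abs_mul]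
  have hb1 : |γ.ξ θ t Y * Real.cos (γ.α θ t Y / 2) ^ 4| ≤ γ.ξ θ t Y := by
    rw [abs_of_nonneg (mul_nonneg hξ (by positivity))]
    exact mul_cos_pow_four_le hξ _
  have hb2 := abs_half_mul_sin_mul_cos_sq_le hξ (γ.α θ t Y)
  generalize γ.ξ θ t Y * Real.cos (γ.α θ t Y / 2) ^ 4 = A at *
  generalize 1 / 2 * γ.ξ θ t Y * Real.sin (γ.α θ t Y) * Real.cos (γ.α θ t Y / 2) ^ 2 = B at *
  generalize deriv (fun s => γ.x s t Y) θ = X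
  generalize deriv (fun s => γ.u s t Y) θ = U
  -- The relabelling drops out of the area form, so it may be put in for free.
  rw [show U * A - B * X = (U + B * η θ Y) * A - B * (X + A * η θ Y) by ring]
  simp only [abs_mul, abs_of_nonneg hξ, Real.abs_exp]
  calc _ ≤ Real.exp (-|γ.x θ t Y|) *
        (|U + B * η θ Y| * γ.ξ θ t Y + γ.ξ θ t Y * |X + A * η θ Y|) := by
        refine mul_le_mul (hψw _) ((abs_sub _ _).trans ?_) (abs_nonneg _) (Real.exp_pos _).le
        rw [abs_mul, abs_mul]
        gcongr
    _ = _ := by ring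

/-- The weighted `L¹` distance of the end points of a path is at most its length. -/
theorem lintegral_weighted_sub_le_length (γ : RegularPath T) (ht : 0 ≤ t) :
    ∫⁻ z, ENNReal.ofReal (|γ.v 1 t z - γ.v 0 t z| * Real.exp (-|z|)) ≤ γ.length t := by
  have h0 : (0 : ℝ) ∈ Icc (0 : ℝ) 1 := ⟨le_rfl, zero_le_one⟩
  have h1 : (1 : ℝ) ∈ Icc (0 : ℝ) 1 := ⟨zero_le_one, le_rfl⟩
  have hv0 : Continuous (γ.v 0 t) := ((γ.conservative 0 h0).mem t ht).continuous
  have hv1 : Continuous (γ.v 1 t) := ((γ.conservative 1 h1).mem t ht).continuous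
  refine le_iInf₂ fun η _ => ?_
  refine lintegral_weighted_le_of_forall_test (hv1.sub hv0) (by fun_prop)
    (fun z => Real.exp_pos _) integrable_exp_neg_abs fun ψ hψ hψc hψw => ?_
  obtain ⟨R, hR⟩ := hψc.isCompact.isBounded.subset_closedBall 0
  have hψR : ∀ z, ψ z ≠ 0 → |z| ≤ R := fun z hz => by
    simpa using hR (subset_tsupport _ hz)
  obtain ⟨M, hM0, hM⟩ := exists_forall_lt_of_monotone_surjective (x := fun θ => γ.x θ t)
    (isCompact_Icc (a := (0 : ℝ)) (b := 1))
    (fun Y => ((γ.continuousOn t ht).comp (f := fun θ => (Y, θ)) (by fun_prop)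
      fun θ hθ => ⟨mem_univ _, hθ⟩).fst)
    (fun θ hθ => (γ.semilinear θ hθ).monotone ht) (fun θ hθ => (γ.represents θ hθ).surjective ht) R
  have hψM : ∀ θ ∈ Icc (0 : ℝ) 1, ψ (γ.x θ t M) = 0 ∧ ψ (γ.x θ t (-M)) = 0 := by
    refine fun θ hθ => ⟨?_, ?_⟩ <;> by_contra h <;> have h' := abs_le.1 (hψR _ h)
    · linarith [(hM θ hθ).1]
    · linarith [(hM θ hθ).2]
  have hpair : ∀ θ ∈ Icc (0 : ℝ) 1, γ.testPairing ψ M t θ = ∫ z, ψ z * γ.v θ t z := fun θ hθ =>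
    testPairing_eq_integral hψ.continuous ht hθ fun z hz => by
      have := abs_le.1 (hψR z hz)
      constructor <;> linarith [(hM θ hθ).1, (hM θ hθ).2]
  have hcont := continuousOn_testPairing (γ := γ) hψ.continuous M ht
  set K : ℝ → ℝ≥0∞ := fun θ => ∫⁻ Y, ENNReal.ofReal (|γ.J₁ η t θ Y| + |γ.J₂ η t θ Y|)
  have hstep : ∀ i < γ.N, ‖γ.testPairing ψ M t (γ.brk (i + 1)) - γ.testPairing ψ M t (γ.brk i)‖ₑ ≤
      ∫⁻ θ in Ioc (γ.brk i) (γ.brk (i + 1)), K θ := by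
    intro i hi
    have hsub : Icc (γ.brk i) (γ.brk (i + 1)) ⊆ Icc 0 1 :=
      Icc_subset_Icc (γ.brk_mem hi.le).1 (γ.brk_mem hi).2
    have hD : ∀ θ ∈ Ioo (γ.brk i) (γ.brk (i + 1)), ∃ D : ℝ,
        HasDerivAt (γ.testPairing ψ M t) D θ ∧ ‖D‖ₑ ≤ K θ := fun θ hθ =>
      exists_hasDerivAt_testPairing hψ hψw hM0 ht hi hθ
        (hψM θ (hsub (Ioo_subset_Icc_self hθ))).1 (hψM θ (hsub (Ioo_subset_Icc_self hθ))).2 η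
    refine enorm_sub_le_lintegral_of_hasDerivAt (F' := deriv (γ.testPairing ψ M t))
      (γ.brk_lt i hi).le (hcont.mono hsub) (fun θ hθ => ?_) fun θ hθ => ?_
    · obtain ⟨D, hD, -⟩ := hD θ hθ
      exact hD.differentiableAt.hasDerivAt
    · obtain ⟨D, hD, hDK⟩ := hD θ hθ
      rwa [hD.deriv]
  have hsum : ∀ n ≤ γ.N, ‖γ.testPairing ψ M t (γ.brk n) - γ.testPairing ψ M t (γ.brk 0)‖ₑ ≤
      ∫⁻ θ in Ioc (γ.brk 0) (γ.brk n), K θ := by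
    intro n
    induction n with
    | zero => simp
    | succ n ih =>
      intro hn
      rw [← Ioc_union_Ioc_eq_Ioc (γ.brk_mono n.zero_le (by omega)) (γ.brk_mono n.le_succ hn),
        lintegral_union measurableSet_Ioc (Ioc_disjoint_Ioc_of_le le_rfl),
        add_comm (∫⁻ _ in _, _), ← sub_add_sub_cancel _ (γ.testPairing ψ M t (γ.brk n))]
      exact (enorm_add_le _ _).trans (add_le_add (hstep n (by omega)) (ih (by omega)))
  have hfin := hsum γ.N le_rfl
  have hi : ∀ v : ℝ → ℝ, Continuous v → Integrable fun z => ψ z * v z := fun v hv =>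
    (hψ.continuous.mul hv).integrable_of_hasCompactSupport hψc.mul_right
  rw [γ.brk_zero, γ.brk_last, hpair 0 h0, hpair 1 h1, ← integral_sub (hi _ hv1) (hi _ hv0)] at hfin
  simp only [← mul_sub] at hfin
  refine hfin.trans ((lintegral_mono_set Ioc_subset_Icc_self).trans
    (lintegral_mono fun θ => lintegral_mono fun Y => ENNReal.ofReal_le_ofReal ?_))
  linarith [abs_nonneg (γ.J₃ η t θ Y), abs_nonneg (γ.J₄ η t θ Y)]

end RegularPath

/-! ### Passage to the geodesic distance -/

theorem eLpNorm_weighted_eq_lintegral (f : ℝ → ℝ) :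
    eLpNorm (fun z => f z * Real.exp (-|z|)) 1 volume =
      ∫⁻ z, ENNReal.ofReal (|f z| * Real.exp (-|z|)) := by
  rw [eLpNorm_one_eq_lintegral_enorm]
  refine lintegral_congr fun z => ?_
  rw [← ofReal_norm, norm_mul, Real.norm_eq_abs, Real.norm_eq_abs, Real.abs_exp]

theorem eLpNorm_weighted_sub_le_genericDist (E₁ E₂ T : ℝ) {t : ℝ} (ht : 0 ≤ t) (u u' : ℝ → ℝ → ℝ) :
    eLpNorm (fun z => (u t z - u' t z) * Real.exp (-|z|)) 1 volume ≤
      genericDist E₁ E₂ T t u u' := by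
  refine le_iInf₂ fun γ hγ => ?_
  rw [eLpNorm_weighted_eq_lintegral]
  simp only [← hγ.1, ← hγ.2.1, abs_sub_comm (γ.v 0 t _)]
  exact γ.lintegral_weighted_sub_le_length ht

theorem memLp_exp_neg_abs_two : MemLp (fun z : ℝ => Real.exp (-|z|)) 2 volume := by
  rw [memLp_two_iff_integrable_sq (by fun_prop)]
  refine integrable_exp_neg_abs.mono' (by fun_prop) (.of_forall fun z => ?_)
  rw [Real.norm_of_nonneg (sq_nonneg _), ← Real.exp_nat_mul, Real.exp_le_exp]
  push_cast
  linarith [abs_nonneg z]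

theorem eLpNorm_weighted_le_sobolevDist {f g : ℝ → ℝ} (hf : MemH1W14 f) (hg : MemH1W14 g) :
    eLpNorm (fun z => (f z - g z) * Real.exp (-|z|)) 1 volume ≤
      sobolevDist f g * eLpNorm (fun z : ℝ => Real.exp (-|z|)) 2 volume := by
  refine (eLpNorm_smul_le_mul_eLpNorm (p := 2) (q := 2) (r := 1)
    (φ := fun z => f z - g z) (f := fun z : ℝ => Real.exp (-|z|))
    memLp_exp_neg_abs_two.aestronglyMeasurable
    (hf.memLp_two.sub hg.memLp_two).aestronglyMeasurable).trans ?_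
  gcongr
  exact le_self_add.trans le_self_add

theorem eLpNorm_weighted_sub_le_isDistLimit {E₁ E₂ T t : ℝ} (ht : 0 ≤ t) {u u' : ℝ → ℝ → ℝ}
    (hu : IsConservativeSolution u) (hu' : IsConservativeSolution u') {δ : ℝ≥0∞}
    (hδ : IsDistLimit E₁ E₂ T t u u' δ) :
    eLpNorm (fun z => (u t z - u' t z) * Real.exp (-|z|)) 1 volume ≤ δ := by
  obtain ⟨a, b, ha, hb, hau, hbu, hab⟩ := hδ
  set W := eLpNorm (fun z : ℝ => Real.exp (-|z|)) 2 volume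
  have hW : W ≠ ⊤ := memLp_exp_neg_abs_two.eLpNorm_ne_top
  have hmu := hu.mem t ht
  have hmu' := hu'.mem t ht
  have key : ∀ n, eLpNorm (fun z => (u t z - u' t z) * Real.exp (-|z|)) 1 volume ≤
      sobolevDist (a n t) (u t) * W + genericDist E₁ E₂ T t (a n) (b n) +
        sobolevDist (b n t) (u' t) * W := by
    intro n
    have hma := (ha n).conservative.mem t ht
    have hmb := (hb n).conservative.mem t ht
    have hm : ∀ {f g : ℝ → ℝ}, MemH1W14 f → MemH1W14 g →
        AEStronglyMeasurable (fun z => (f z - g z) * Real.exp (-|z|)) volume := fun hf hg =>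
      ((hf.continuous.sub hg.continuous).mul (by fun_prop)).aestronglyMeasurable
    have hdecomp : (fun z => (u t z - u' t z) * Real.exp (-|z|)) =
        -(fun z => (a n t z - u t z) * Real.exp (-|z|)) +
          (fun z => (a n t z - b n t z) * Real.exp (-|z|)) +
          fun z => (b n t z - u' t z) * Real.exp (-|z|) := by
      ext z
      simp only [Pi.add_apply, Pi.neg_apply]
      ring
    rw [hdecomp]
    refine (eLpNorm_add_le ((hm hma hmu).neg.add (hm hma hmb)) (hm hmb hmu') le_rfl).trans ?_
    gcongr
    · refine (eLpNorm_add_le (hm hma hmu).neg (hm hma hmb) le_rfl).trans ?_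
      rw [eLpNorm_neg]
      gcongr
      · exact eLpNorm_weighted_le_sobolevDist hma hmu
      · exact eLpNorm_weighted_sub_le_genericDist E₁ E₂ T ht (a n) (b n)
    · exact eLpNorm_weighted_le_sobolevDist hmb hmu'
  have hlim := ((ENNReal.Tendsto.mul_const hau (.inr hW)).add hab).add
    (ENNReal.Tendsto.mul_const hbu (.inr hW))
  simp only [zero_mul, zero_add, add_zero] at hlim
  exact ge_of_tendsto' hlim key

end Novikov

end

theorem proposition7p2 (E₁ E₂ : ℝ) (hE₁ : 0 < E₁) (hE₂ : 0 < E₂) :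
    ∃ C : ℝ, 0 < C ∧ ∀ (T t : ℝ), 0 < T → 0 ≤ t → t ≤ T →
      ∀ u u' : ℝ → ℝ → ℝ,
        Novikov.IsConservativeSolution u → Novikov.IsConservativeSolution u' →
        MeasureTheory.eLpNorm (fun x => (u t x - u' t x) * Real.exp (-|x|)) 1
            MeasureTheory.volume ≤
          ENNReal.ofReal C * Novikov.geodesicDist E₁ E₂ T t u u' := by
  refine ⟨1, one_pos, fun T t _ ht _ u u' hu hu' => ?_⟩
  rw [ENNReal.ofReal_one, one_mul]
  exact le_sInf fun δ hδ => Novikov.eLpNorm_weighted_sub_le_isDistLimit ht hu hu' hδ
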